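/- Fix a set of propositional variables. Formulas of the language $\mathcal L$ are given by $A ::= p \mid \neg A \mid A\to A \mid \Box A \mid \bigcirc(A/A)$, with $A\wedge B := \neg(A\to\neg B)$ and $A\leftrightarrow B := (A\to B)\wedge(B\to A)$. The Hilbert system $\mathbf E$ (Åqvist's dyadic deontic logic) consists of classical propositional logic (all instances of tautologies), the S5 axioms $\Box(A\to B)\to(\Box A\to\Box B)$, $\Box A\to A$, $\neg\Box A\to\Box\neg\Box A$, the axioms - $\bigcirc(B\to C/A)\to(\bigcirc(B/A)\to\bigcirc(C/A))$, - $\bigcirc(A/A)$, - $\bigcirc(C/A\wedge B)\to\bigcirc(B\to C/A)$, - $\Box(A\leftrightarrow B)\to(\bigcirc(C/A)\leftrightarrow\bigcirc(C/B))$, - $\bigcirc(B/A)\to\Box\bigcirc(B/A)$, - $\Box A\to\bigcirc(A/B)$, and the rules: from $A$ and $A\to B$ infer $B$; from $A$ infer $\Box A$. The calculus $\mathbf{HE}$ operates on hypersequents, i.e. finite multisets $\Gamma_1\Rightarrow\Delta_1\mid\dots\mid\Gamma_n\Rightarrow\Delta_n$ of sequents, where the $\Gamma_i,\Delta_i$ are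 finite multisets of formulas of the language $\mathcal L$ extended by a unary modality $\mathcal{B}et$. Write $\Gamma^\Box$ and $\Gamma^O$ for the formulas in $\Gamma$ of the form $\Box A$, respectively $\bigcirc(B/A)$, and $\Gamma^{b\downarrow}=\{A : \mathcal{B}et\,A\in\Gamma\}$. The initial hypersequents are $G\mid\Gamma,p\Rightarrow\Delta,p$ with $p$ a propositional variable. The rules (for an arbitrary, possibly empty, context hypersequent $G$) are: - internal weakening and contraction on both sides, and the usual LK rules for $\neg$ and $\to$, inside one component; - (ew) from $G$ infer $G\mid\Gamma\Rightarrow\Delta$; (ec) from $G\mid\Gamma\Rightarrow\Delta\mid\Gamma\Rightarrow\Delta$ infer $G\mid\Gamma\Rightarrow\Delta$; - (s5$'$) from $G\mid\Gamma^\Box,\Gamma^O,\Gamma'\Rightarrow\Delta'$ infer $G\mid\Gamma\Rightarrow\;\mid\Gamma'\Rightarrow\Delta'$; - ($\Box$R) from $G\mid\Gamma^\Box,\Gamma^O\Rightarrow A$ infer $G\mid\Gamma\Rightarrow\Delta,\Box A$; ($\Box$L) from $G\mid\Gamma,\Box A,A\Rightarrow\Delta$ infer $G\mid\Gamma,\Box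 A\Rightarrow\Delta$; - ($\bigcirc$R) from $G\mid\Gamma^\Box,\Gamma^O,A,\mathcal{B}et\,\neg A\Rightarrow B$ infer $G\mid\Gamma\Rightarrow\Delta,\bigcirc(B/A)$; - ($\bigcirc$L) from $G\mid\Gamma,\bigcirc(B/A)\Rightarrow\Delta,A$ and $G\mid\Gamma,\bigcirc(B/A)\Rightarrow\Delta,\mathcal{B}et\,\neg A$ and $G\mid\Gamma,\bigcirc(B/A),B\Rightarrow\Delta$ infer $G\mid\Gamma,\bigcirc(B/A)\Rightarrow\Delta$; - ($\mathcal{B}et$) from $G\mid\Gamma^\Box,\Gamma^O,\Gamma^{b\downarrow}\Rightarrow A$ infer $G\mid\Gamma\Rightarrow\Delta,\mathcal{B}et\,A$. There is no cut rule. A proof is a finite tree of rule applications all of whose leaves are initial hypersequents. **Corollary (Completeness).** For every theorem $A$ of $\mathbf E$, the hypersequent $\;\Rightarrow A\;$ has a (cut-free) proof in $\mathbf{HE}$. -/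

import Mathlib

namespace AqvistE

universe u

/-- The language of **E** over a type `P` of propositional variables.
`obl B A` is the conditional obligation `○(B/A)` ("`B` is obligatory, given `A`"). -/
inductive Formula (P : Type u) : Type u
  | var (p : P) : Formula P
  | neg (A : Formula P) : Formula P
  | imp (A B : Formula P) : Formula P
  | box (A : Formula P) : Formula P
  | obl (B A : Formula P) : Formula P

namespace Formula

variable {P : Type u}

/-- `A ∧ B`, defined as usual from `¬` and `→`. -/
def conj (A B : Formula P) : Formula P := neg (imp A (neg B))

/-- `A ↔ B`, defined as usual. -/
def equiv (A B : Formula P) : Formula P := conj (imp A B) (imp B A)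

/-- `A` is a (substitution instance of a) classical propositional tautology: it is true under
every two-valued assignment to formulas that respects `¬` and `→`, and that treats variables,
boxed formulas and conditional obligations as atoms. -/
def IsTautology (A : Formula P) : Prop :=
  ∀ v : Formula P → Prop,
    (∀ B, v (neg B) ↔ ¬ v B) → (∀ B C, v (imp B C) ↔ (v B → v C)) → v A

end Formula

open Formula in
/-- `ProvableE A`: the formula `A` is a theorem of the Hilbert system **E**. The classical
propositional base is given by all tautologies (the theorems of any Hilbert system for classical
propositional logic, in the language of **E**). -/
inductive ProvableE {P : Type u} : Formula P → Prop
  | taut {A : Formula P} : IsTautology A → ProvableE A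
  | boxK (A B : Formula P) : ProvableE (imp (box (imp A B)) (imp (box A) (box B)))
  | boxT (A : Formula P) : ProvableE (imp (box A) A)
  | box5 (A : Formula P) : ProvableE (imp (neg (box A)) (box (neg (box A))))
  | COK (A B C : Formula P) : ProvableE (imp (obl (imp B C) A) (imp (obl B A) (obl C A)))
  | Id (A : Formula P) : ProvableE (obl A A)
  | Sh (A B C : Formula P) : ProvableE (imp (obl C (conj A B)) (obl (imp B C) A))
  | Ext (A B C : Formula P) : ProvableE (imp (box (equiv A B)) (equiv (obl C A) (obl C B)))
  | Abs (A B : Formula P) : ProvableE (imp (obl B A) (box (obl B A)))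
  | ONec (A B : Formula P) : ProvableE (imp (box A) (obl A B))
  | MP {A B : Formula P} : ProvableE A → ProvableE (imp A B) → ProvableE B
  | Nec {A : Formula P} : ProvableE A → ProvableE (box A)

/-- The language of **E** extended by the unary modality `Bet`, used in the hypersequent calculus. -/
inductive BFormula (P : Type u) : Type u
  | var (p : P) : BFormula P
  | neg (A : BFormula P) : BFormula P
  | imp (A B : BFormula P) : BFormula P
  | box (A : BFormula P) : BFormula P
  | obl (B A : BFormula P) : BFormula P
  | bet (A : BFormula P) : BFormula P

/-- The inclusion of the language of **E** into the extended language. -/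
def Formula.toB {P : Type u} : Formula P → BFormula P
  | .var p => .var p
  | .neg A => .neg A.toB
  | .imp A B => .imp A.toB B.toB
  | .box A => .box A.toB
  | .obl B A => .obl B.toB A.toB

namespace BFormula

variable {P : Type u}

/-- Is the formula of the form `□ A`? -/
def isBox : BFormula P → Bool
  | box _ => true
  | _ => false

/-- Is the formula of the form `○(B/A)`? -/
def isObl : BFormula P → Bool
  | obl _ _ => true
  | _ => false

/-- `Bet A ↦ A`, undefined on other formulas. -/
def unBet? : BFormula P → Option (BFormula P)
  | bet A => some A
  | _ => none

end BFormula

/-- `Γ^□`: the formulas of the form `□ A` in `Γ`. -/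
def boxPart {P : Type u} (Γ : Multiset (BFormula P)) : Multiset (BFormula P) :=
  Γ.filter fun A => A.isBox = true

/-- `Γ^O`: the formulas of the form `○(B/A)` in `Γ`. -/
def oblPart {P : Type u} (Γ : Multiset (BFormula P)) : Multiset (BFormula P) :=
  Γ.filter fun A => A.isObl = true

/-- `Γ^{b↓}`: the formulas `A` with `Bet A` in `Γ`. -/
def betPart {P : Type u} (Γ : Multiset (BFormula P)) : Multiset (BFormula P) :=
  Γ.filterMap BFormula.unBet?

/-- A sequent `ant ⇒ suc`. -/
structure Sequent (P : Type u) : Type u where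
  ant : Multiset (BFormula P)
  suc : Multiset (BFormula P)

infix:60 " ⟹ " => Sequent.mk

/-- A hypersequent is a finite multiset of sequents, its components. -/
abbrev Hypersequent (P : Type u) : Type u := Multiset (Sequent P)

open BFormula in
/-- `ProvableHE H`: the hypersequent `H` has a proof in **HE**, that is, a finite tree of rule
applications with root `H` all of whose leaves are initial hypersequents.
There is no cut rule. The formula displayed as `A ::ₘ Γ` is written `Γ, A` on paper, and
`S ::ₘ G` is the hypersequent `G | S`. -/
inductive ProvableHE {P : Type u} : Hypersequent P → Prop
  -- initial hypersequents
  | init (G : Hypersequent P) (Γ Δ : Multiset (BFormula P)) (p : P) :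
      ProvableHE ((var p ::ₘ Γ ⟹ var p ::ₘ Δ) ::ₘ G)
  -- internal structural rules: weakening and contraction
  | wL (G : Hypersequent P) (Γ Δ : Multiset (BFormula P)) (A : BFormula P) :
      ProvableHE ((Γ ⟹ Δ) ::ₘ G) → ProvableHE ((A ::ₘ Γ ⟹ Δ) ::ₘ G)
  | wR (G : Hypersequent P) (Γ Δ : Multiset (BFormula P)) (A : BFormula P) :
      ProvableHE ((Γ ⟹ Δ) ::ₘ G) → ProvableHE ((Γ ⟹ A ::ₘ Δ) ::ₘ G)
  | cL (G : Hypersequent P) (Γ Δ : Multiset (BFormula P)) (A : BFormula P) :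
      ProvableHE ((A ::ₘ A ::ₘ Γ ⟹ Δ) ::ₘ G) → ProvableHE ((A ::ₘ Γ ⟹ Δ) ::ₘ G)
  | cR (G : Hypersequent P) (Γ Δ : Multiset (BFormula P)) (A : BFormula P) :
      ProvableHE ((Γ ⟹ A ::ₘ A ::ₘ Δ) ::ₘ G) → ProvableHE ((Γ ⟹ A ::ₘ Δ) ::ₘ G)
  -- propositional rules
  | negL (G : Hypersequent P) (Γ Δ : Multiset (BFormula P)) (A : BFormula P) :
      ProvableHE ((Γ ⟹ A ::ₘ Δ) ::ₘ G) → ProvableHE ((neg A ::ₘ Γ ⟹ Δ) ::ₘ G)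
  | negR (G : Hypersequent P) (Γ Δ : Multiset (BFormula P)) (A : BFormula P) :
      ProvableHE ((A ::ₘ Γ ⟹ Δ) ::ₘ G) → ProvableHE ((Γ ⟹ neg A ::ₘ Δ) ::ₘ G)
  | impL (G : Hypersequent P) (Γ Δ : Multiset (BFormula P)) (A B : BFormula P) :
      ProvableHE ((Γ ⟹ A ::ₘ Δ) ::ₘ G) → ProvableHE ((B ::ₘ Γ ⟹ Δ) ::ₘ G) →
      ProvableHE ((imp A B ::ₘ Γ ⟹ Δ) ::ₘ G)
  | impR (G : Hypersequent P) (Γ Δ : Multiset (BFormula P)) (A B : BFormula P) :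
      ProvableHE ((A ::ₘ Γ ⟹ B ::ₘ Δ) ::ₘ G) → ProvableHE ((Γ ⟹ imp A B ::ₘ Δ) ::ₘ G)
  -- external structural rules
  | ew (G : Hypersequent P) (Γ Δ : Multiset (BFormula P)) :
      ProvableHE G → ProvableHE ((Γ ⟹ Δ) ::ₘ G)
  | ec (G : Hypersequent P) (Γ Δ : Multiset (BFormula P)) :
      ProvableHE ((Γ ⟹ Δ) ::ₘ (Γ ⟹ Δ) ::ₘ G) → ProvableHE ((Γ ⟹ Δ) ::ₘ G)
  | s5' (G : Hypersequent P) (Γ Γ' Δ' : Multiset (BFormula P)) :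
      ProvableHE ((boxPart Γ + oblPart Γ + Γ' ⟹ Δ') ::ₘ G) →
      ProvableHE ((Γ ⟹ 0) ::ₘ (Γ' ⟹ Δ') ::ₘ G)
  -- modal and deontic rules
  | boxR (G : Hypersequent P) (Γ Δ : Multiset (BFormula P)) (A : BFormula P) :
      ProvableHE ((boxPart Γ + oblPart Γ ⟹ {A}) ::ₘ G) →
      ProvableHE ((Γ ⟹ box A ::ₘ Δ) ::ₘ G)
  | boxL (G : Hypersequent P) (Γ Δ : Multiset (BFormula P)) (A : BFormula P) :
      ProvableHE ((A ::ₘ box A ::ₘ Γ ⟹ Δ) ::ₘ G) → ProvableHE ((box A ::ₘ Γ ⟹ Δ) ::ₘ G)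
  | oblR (G : Hypersequent P) (Γ Δ : Multiset (BFormula P)) (A B : BFormula P) :
      ProvableHE ((A ::ₘ bet (neg A) ::ₘ (boxPart Γ + oblPart Γ) ⟹ {B}) ::ₘ G) →
      ProvableHE ((Γ ⟹ obl B A ::ₘ Δ) ::ₘ G)
  | oblL (G : Hypersequent P) (Γ Δ : Multiset (BFormula P)) (A B : BFormula P) :
      ProvableHE ((obl B A ::ₘ Γ ⟹ A ::ₘ Δ) ::ₘ G) →
      ProvableHE ((obl B A ::ₘ Γ ⟹ bet (neg A) ::ₘ Δ) ::ₘ G) →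
      ProvableHE ((B ::ₘ obl B A ::ₘ Γ ⟹ Δ) ::ₘ G) →
      ProvableHE ((obl B A ::ₘ Γ ⟹ Δ) ::ₘ G)
  | betR (G : Hypersequent P) (Γ Δ : Multiset (BFormula P)) (A : BFormula P) :
      ProvableHE ((boxPart Γ + oblPart Γ + betPart Γ ⟹ {A}) ::ₘ G) →
      ProvableHE ((Γ ⟹ bet A ::ₘ Δ) ::ₘ G)

end AqvistE

/-! Cut-free completeness is proved semantically. **E** is sound for preference models with an
arbitrary betterness relation (`ProvableE.sat`), so it suffices to build a countermodel to `A`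
whenever `⇒ A` has no cut-free proof. Only finitely many hypersequents have pairs of subsets of
`A.closure` as components, so `⇒ A` extends to a maximal unprovable one, `H` (`exists_saturated`).
The worlds are the inclusion-maximal components of `H`, and `z` is better than `y` when `Bet B` on
the left of `y` forces `B` on the left of `z`. Without cut, a world need not decide every formula of
the closure. Hence `Saturated.truth` claims only that formulas on the left are true and formulas on
the right are false. Read contrapositively, each rule gives one clause: an unprovable conclusion has
an unprovable premise, and by saturation that premise already lies below some world. -/

namespace AqvistE

universe v

/-! ### Preference models and soundness of **E**. -/

section Semantics

variable {P : Type u} {W : Type v}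

/-- Truth at a world of a preference model: `R x y` says that `y` is better than `x`, `□` is the
universal modality, `Bet A` says that `A` holds at all better worlds, and `○(B/A)` says that `B`
holds at all `A`-worlds without better `A`-worlds. -/
def Sat (R : W → W → Prop) (V : W → P → Prop) : BFormula P → W → Prop
  | .var p, x => V x p
  | .neg A, x => ¬ Sat R V A x
  | .imp A B, x => Sat R V A x → Sat R V B x
  | .box A, _ => ∀ y, Sat R V A y
  | .obl B A, _ => ∀ y, Sat R V A y → (∀ z, R y z → ¬ Sat R V A z) → Sat R V B y
  | .bet A, x => ∀ y, R x y → Sat R V A y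

/-- The system **E** is sound for preference models. -/
theorem ProvableE.sat (R : W → W → Prop) (V : W → P → Prop) {A : Formula P}
    (h : ProvableE A) : ∀ x, Sat R V A.toB x := by
  induction h with
  | taut h =>
    intro x
    exact h (fun B => Sat R V B.toB x) (fun _ => Iff.rfl) (fun _ _ => Iff.rfl)
  | boxK A B => exact fun x h₁ h₂ y => h₁ y (h₂ y)
  | boxT A => exact fun x h => h x
  | box5 A => exact fun x h _ => h
  | COK A B C => exact fun x h₁ h₂ y hA hb => h₁ y hA hb (h₂ y hA hb)
  | Id A => exact fun x y hA _ => hA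
  | Sh A B C =>
    -- A best `A`-world satisfying `B` is also best among the `A ∧ B`-worlds, since every one of
    -- these is an `A`-world.
    exact fun x h y hA hb hB => h y (fun k => k hA hB) fun z hz hk =>
      hk fun hAz _ => hb z hz hAz
  | Ext A B C =>
    intro x h
    have e : ∀ y, Sat R V A.toB y ↔ Sat R V B.toB y := fun y => by
      by_contra hne
      exact h y fun h₁ h₂ => hne ⟨h₁, h₂⟩
    simp only [Formula.equiv, Formula.conj, Formula.toB, Sat, e]
    exact fun k => k id id
  | Abs A B => exact fun x h _ => h
  | ONec A B => exact fun x h y _ _ => h y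
  | MP _ _ h₁ h₂ => exact fun x => h₂ x (h₁ x)
  | Nec _ h => exact fun x y => h y

end Semantics

/-! ### Derived structural rules: only underlying sets matter. -/

section Structural

variable {P : Type u}

namespace ProvableHE

/-- Multiset inclusion `⊆` ignores multiplicities: weaken by all of `Γ'`, then contract each formula
of `Γ` into its copy in `Γ'`. -/
theorem left_mono {G : Hypersequent P} {Γ Γ' Δ : Multiset (BFormula P)}
    (h : ProvableHE ((Γ ⟹ Δ) ::ₘ G)) (hΓ : Γ ⊆ Γ') : ProvableHE ((Γ' ⟹ Δ) ::ₘ G) := by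
  have hw : ∀ Θ : Multiset (BFormula P), ProvableHE ((Θ + Γ ⟹ Δ) ::ₘ G) := by
    intro Θ
    induction Θ using Multiset.induction_on with
    | empty => simpa using h
    | cons A Θ ih => rw [Multiset.cons_add]; exact wL _ _ _ _ ih
  have hc : ∀ Θ : Multiset (BFormula P), Θ ⊆ Γ' → ProvableHE ((Γ' + Θ ⟹ Δ) ::ₘ G) →
      ProvableHE ((Γ' ⟹ Δ) ::ₘ G) := by
    intro Θ
    induction Θ using Multiset.induction_on with
    | empty => intro _ h; simpa using h
    | cons A Θ ih =>
      intro hs h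
      rw [Multiset.cons_subset] at hs
      obtain ⟨T, rfl⟩ := Multiset.exists_cons_of_mem hs.1
      refine ih hs.2 ?_
      rw [Multiset.cons_add] at h ⊢
      rw [Multiset.add_cons] at h
      exact cL _ _ _ _ h
  exact hc Γ hΓ (hw Γ')

theorem right_mono {G : Hypersequent P} {Γ Δ Δ' : Multiset (BFormula P)}
    (h : ProvableHE ((Γ ⟹ Δ) ::ₘ G)) (hΔ : Δ ⊆ Δ') : ProvableHE ((Γ ⟹ Δ') ::ₘ G) := by
  have hw : ∀ Θ : Multiset (BFormula P), ProvableHE ((Γ ⟹ Θ + Δ) ::ₘ G) := by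
    intro Θ
    induction Θ using Multiset.induction_on with
    | empty => simpa using h
    | cons A Θ ih => rw [Multiset.cons_add]; exact wR _ _ _ _ ih
  have hc : ∀ Θ : Multiset (BFormula P), Θ ⊆ Δ' → ProvableHE ((Γ ⟹ Δ' + Θ) ::ₘ G) →
      ProvableHE ((Γ ⟹ Δ') ::ₘ G) := by
    intro Θ
    induction Θ using Multiset.induction_on with
    | empty => intro _ h; simpa using h
    | cons A Θ ih =>
      intro hs h
      rw [Multiset.cons_subset] at hs
      obtain ⟨T, rfl⟩ := Multiset.exists_cons_of_mem hs.1
      refine ih hs.2 ?_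
      rw [Multiset.cons_add] at h ⊢
      rw [Multiset.add_cons] at h
      exact cR _ _ _ _ h
  exact hc Δ hΔ (hw Δ')

theorem mono {G : Hypersequent P} {Γ Γ' Δ Δ' : Multiset (BFormula P)}
    (h : ProvableHE ((Γ ⟹ Δ) ::ₘ G)) (hΓ : Γ ⊆ Γ') (hΔ : Δ ⊆ Δ') :
    ProvableHE ((Γ' ⟹ Δ') ::ₘ G) :=
  (h.left_mono hΓ).right_mono hΔ

theorem external_mono {G G' : Hypersequent P} (h : ProvableHE G) (hG : G ⊆ G') :
    ProvableHE G' := by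
  have hw : ∀ K : Hypersequent P, ProvableHE (K + G) := by
    intro K
    induction K using Multiset.induction_on with
    | empty => simpa using h
    | cons S K ih => rw [Multiset.cons_add]; exact ew _ _ _ ih
  have hc : ∀ K : Hypersequent P, K ⊆ G' → ProvableHE (G' + K) → ProvableHE G' := by
    intro K
    induction K using Multiset.induction_on with
    | empty => intro _ h; simpa using h
    | cons S K ih =>
      intro hs h
      rw [Multiset.cons_subset] at hs
      obtain ⟨T, rfl⟩ := Multiset.exists_cons_of_mem hs.1
      refine ih hs.2 ?_
      rw [Multiset.cons_add] at h ⊢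
      rw [Multiset.add_cons] at h
      exact ec _ _ _ h
  exact hc G hG (hw G')

/-- A component contained in another component of the same hypersequent is redundant. -/
theorem absorb {G : Hypersequent P} {Γ Γ' Δ Δ' : Multiset (BFormula P)}
    (h : ProvableHE ((Γ ⟹ Δ) ::ₘ G)) (hG : (Γ' ⟹ Δ') ∈ G) (hΓ : Γ ⊆ Γ') (hΔ : Δ ⊆ Δ') :
    ProvableHE G :=
  (h.mono hΓ hΔ).external_mono (Multiset.cons_subset.2 ⟨hG, fun _ => id⟩)

end ProvableHE

end Structural

/-! ### The finite closure of a formula. -/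

namespace BFormula

variable {P : Type u}

open Classical in
/-- The formulas that a root-first proof search for `A` may introduce. -/
noncomputable def closure : BFormula P → Finset (BFormula P)
  | var p => {var p}
  | neg A => insert (neg A) A.closure
  | imp A B => insert (imp A B) (A.closure ∪ B.closure)
  | box A => insert (box A) A.closure
  -- The rules for `○` introduce `Bet ¬A`, from which the `Bet` rule extracts `¬A`.
  | obl B A => insert (obl B A) (insert (bet (neg A)) (insert (neg A) (A.closure ∪ B.closure)))
  | bet A => insert (bet A) A.closure

theorem mem_closure_self (A : BFormula P) : A ∈ A.closure := by
  cases A <;> simp [closure]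

open Classical in
theorem closure_subset {A B : BFormula P} (h : B ∈ A.closure) : B.closure ⊆ A.closure := by
  induction A with
  | var p => simp only [closure, Finset.mem_singleton] at h; subst h; rfl
  | neg A ih | box A ih | bet A ih =>
    simp only [closure, Finset.mem_insert] at h
    rcases h with rfl | h
    · rfl
    · exact (ih h).trans (Finset.subset_insert _ _)
  | imp A C ihA ihC =>
    simp only [closure, Finset.mem_insert, Finset.mem_union] at h
    rcases h with rfl | h | h
    · rfl
    · intro D hD; simp [closure, ihA h hD]
    · intro D hD; simp [closure, ihC h hD]
  | obl C A ihC ihA =>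
    simp only [closure, Finset.mem_insert, Finset.mem_union] at h
    rcases h with rfl | rfl | rfl | h | h
    · rfl
    · intro D hD; simp only [closure, Finset.mem_insert, Finset.mem_union] at hD ⊢; tauto
    · intro D hD; simp only [closure, Finset.mem_insert, Finset.mem_union] at hD ⊢; tauto
    · intro D hD; simp [closure, ihA h hD]
    · intro D hD; simp [closure, ihC h hD]

end BFormula

/-! ### Saturated hypersequents and the canonical countermodel. -/

section Completeness

variable {P : Type u}

/-- The hypersequent whose components are the given pairs of finite sets. -/
def toHyp (H : Finset (Finset (BFormula P) × Finset (BFormula P))) : Hypersequent P :=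
  H.val.map fun c => c.1.val ⟹ c.2.val

theorem mem_toHyp {H : Finset (Finset (BFormula P) × Finset (BFormula P))}
    {c : Finset (BFormula P) × Finset (BFormula P)} (h : c ∈ H) :
    (c.1.val ⟹ c.2.val) ∈ toHyp H :=
  Multiset.mem_map_of_mem _ h

/-- `H` is unprovable, and every unprovable extension of `H` by a component over `F` is below a
component of `H`. -/
structure Saturated (F : Finset (BFormula P))
    (H : Finset (Finset (BFormula P) × Finset (BFormula P))) : Prop where
  unprovable : ¬ ProvableHE (toHyp H)
  bounded : ∀ c ∈ H, c.1 ⊆ F ∧ c.2 ⊆ F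
  exists_ge : ∀ {Γ Δ : Multiset (BFormula P)}, (∀ A ∈ Γ, A ∈ F) → (∀ A ∈ Δ, A ∈ F) →
    ¬ ProvableHE ((Γ ⟹ Δ) ::ₘ toHyp H) →
    ∃ c, Maximal (· ∈ H) c ∧ (∀ A ∈ Γ, A ∈ c.1) ∧ ∀ A ∈ Δ, A ∈ c.2

-- Take `H` maximal among the finitely many unprovable candidates. A component that can be added
-- without making `H` provable already belongs to `H`, after forgetting multiplicities, and so lies
-- below a maximal component.
open Classical in
theorem exists_saturated (F : Finset (BFormula P))
    (H₀ : Finset (Finset (BFormula P) × Finset (BFormula P)))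
    (h₀ : ¬ ProvableHE (toHyp H₀)) (hb : ∀ c ∈ H₀, c.1 ⊆ F ∧ c.2 ⊆ F) :
    ∃ H, H₀ ⊆ H ∧ Saturated F H := by
  let U := F.powerset ×ˢ F.powerset
  have hU : ∀ c, c ∈ U ↔ c.1 ⊆ F ∧ c.2 ⊆ F := by simp [U]
  let S : Set (Finset (Finset (BFormula P) × Finset (BFormula P))) :=
    {H | H ⊆ U ∧ ¬ ProvableHE (toHyp H)}
  have hfin : S.Finite :=
    U.powerset.finite_toSet.subset fun H hH => Finset.mem_coe.2 (Finset.mem_powerset.2 hH.1)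
  obtain ⟨H, hle, hmax⟩ := hfin.exists_le_maximal
    (show H₀ ∈ S from ⟨fun c hc => (hU c).2 (hb c hc), h₀⟩)
  refine ⟨H, hle, hmax.prop.2, fun c hc => (hU c).1 (hmax.prop.1 hc), ?_⟩
  intro Γ Δ hΓ hΔ hn
  have hmem : (Γ.toFinset, Δ.toFinset) ∈ H := by
    by_contra hnot
    have hnS : insert (Γ.toFinset, Δ.toFinset) H ∉ S := fun hS =>
      hnot (hmax.le_of_ge hS (Finset.subset_insert _ _) (Finset.mem_insert_self _ _))
    refine hnS ⟨Finset.insert_subset ((hU _).2 ⟨?_, ?_⟩) hmax.prop.1, fun hp => hn ?_⟩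
    · exact fun A hA => hΓ A (Multiset.mem_toFinset.1 hA)
    · exact fun A hA => hΔ A (Multiset.mem_toFinset.1 hA)
    · rw [toHyp, Finset.insert_val_of_notMem hnot, Multiset.map_cons] at hp
      exact hp.mono (fun A hA => Multiset.mem_toFinset.1 hA)
        (fun A hA => Multiset.mem_toFinset.1 hA)
  obtain ⟨c, hc, hcmax⟩ := H.finite_toSet.exists_le_maximal (Finset.mem_coe.2 hmem)
  exact ⟨c, hcmax, fun A hA => hc.1 (Multiset.mem_toFinset.2 hA),
    fun A hA => hc.2 (Multiset.mem_toFinset.2 hA)⟩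

namespace Saturated

variable {F : Finset (BFormula P)} {H : Finset (Finset (BFormula P) × Finset (BFormula P))}

theorem not_provable (hs : Saturated F H) {c : Finset (BFormula P) × Finset (BFormula P)}
    (hc : c ∈ H) {Γ Δ : Multiset (BFormula P)} (hΓ : ∀ A ∈ Γ, A ∈ c.1) (hΔ : ∀ A ∈ Δ, A ∈ c.2) :
    ¬ ProvableHE ((Γ ⟹ Δ) ::ₘ toHyp H) :=
  fun h => hs.unprovable (h.absorb (mem_toHyp hc) (fun A hA => hΓ A hA) fun A hA => hΔ A hA)

/-- Over a maximal component of a saturated hypersequent, a proper extension is provable. -/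
theorem mem_of_not_provable (hs : Saturated F H)
    {c : Finset (BFormula P) × Finset (BFormula P)} (hc : Maximal (· ∈ H) c)
    {Γ Δ : Multiset (BFormula P)} (hΓ : ∀ A ∈ Γ, A ∈ F) (hΔ : ∀ A ∈ Δ, A ∈ F)
    (h : ¬ ProvableHE ((Γ + c.1.val ⟹ Δ + c.2.val) ::ₘ toHyp H)) :
    (∀ A ∈ Γ, A ∈ c.1) ∧ ∀ A ∈ Δ, A ∈ c.2 := by
  have hb := hs.bounded c hc.prop
  obtain ⟨d, hd, h₁, h₂⟩ := hs.exists_ge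
    (fun A hA => (Multiset.mem_add.1 hA).elim (hΓ A) fun h => hb.1 h)
    (fun A hA => (Multiset.mem_add.1 hA).elim (hΔ A) fun h => hb.2 h) h
  have hcd : c ≤ d := ⟨fun A hA => h₁ A (Multiset.mem_add.2 (.inr hA)),
    fun A hA => h₂ A (Multiset.mem_add.2 (.inr hA))⟩
  have hdc := hc.le_of_ge hd.prop hcd
  exact ⟨fun A hA => hdc.1 (h₁ A (Multiset.mem_add.2 (.inl hA))),
    fun A hA => hdc.2 (h₂ A (Multiset.mem_add.2 (.inl hA)))⟩

theorem mem_left (hs : Saturated F H) {c : Finset (BFormula P) × Finset (BFormula P)}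
    (hc : Maximal (· ∈ H) c) {A : BFormula P} (hA : A ∈ F)
    (h : ¬ ProvableHE ((A ::ₘ c.1.val ⟹ c.2.val) ::ₘ toHyp H)) : A ∈ c.1 :=
  (hs.mem_of_not_provable hc (Γ := {A}) (Δ := 0) (by simpa using hA) (by simp)
    (by simpa using h)).1 A (by simp)

theorem mem_right (hs : Saturated F H) {c : Finset (BFormula P) × Finset (BFormula P)}
    (hc : Maximal (· ∈ H) c) {A : BFormula P} (hA : A ∈ F)
    (h : ¬ ProvableHE ((c.1.val ⟹ A ::ₘ c.2.val) ::ₘ toHyp H)) : A ∈ c.2 :=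
  (hs.mem_of_not_provable hc (Γ := 0) (Δ := {A}) (by simp) (by simpa using hA)
    (by simpa using h)).2 A (by simp)

/-- Boxed formulas and conditional obligations on the left spread to all maximal components. -/
theorem spread (hs : Saturated F H) {c d : Finset (BFormula P) × Finset (BFormula P)}
    (hc : c ∈ H) (hd : Maximal (· ∈ H) d) {A : BFormula P} (hA : A ∈ c.1)
    (hf : A.isBox = true ∨ A.isObl = true) : A ∈ d.1 := by
  have hΓ : ∀ B ∈ boxPart c.1.val + oblPart c.1.val, B ∈ c.1 := by
    intro B hB
    simp only [boxPart, oblPart, Multiset.mem_add, Multiset.mem_filter, Finset.mem_val] at hB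
    tauto
  refine (hs.mem_of_not_provable hd (Δ := 0) (fun B hB => (hs.bounded c hc).1 (hΓ B hB))
    (by simp) fun h => ?_).1 A ?_
  · rw [zero_add] at h
    -- The rule (s5') moves the modal part of `c` out of `d` into a separate component `c.1 ⇒`,
    -- which `c` absorbs.
    refine hs.unprovable ((ProvableHE.s5' _ _ _ _ h).external_mono ?_ |>.absorb (mem_toHyp hc)
      (fun _ => id) (Multiset.zero_subset _))
    exact Multiset.cons_subset.2 ⟨Multiset.mem_cons_self _ _, Multiset.cons_subset.2
      ⟨Multiset.mem_cons_of_mem (mem_toHyp hd.prop), Multiset.subset_cons _ _⟩⟩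
  · simp only [boxPart, oblPart, Multiset.mem_add, Multiset.mem_filter, Finset.mem_val]
    tauto

/-- Induction on `A`. Left rules are applied inside a world. The right rules for `□`, `○` and `Bet`
instead produce a new world above their premise, which serves as the counterexample. -/
theorem truth (hs : Saturated F H) (hF : ∀ A ∈ F, A.closure ⊆ F) (A : BFormula P)
    (x : {c // Maximal (· ∈ H) c}) :
    (A ∈ x.1.1 → Sat (W := {c // Maximal (· ∈ H) c})
      (fun y z => ∀ B, BFormula.bet B ∈ y.1.1 → B ∈ z.1.1)
      (fun y p => BFormula.var p ∈ y.1.1) A x) ∧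
    (A ∈ x.1.2 → ¬ Sat (W := {c // Maximal (· ∈ H) c})
      (fun y z => ∀ B, BFormula.bet B ∈ y.1.1 → B ∈ z.1.1)
      (fun y p => BFormula.var p ∈ y.1.1) A x) := by
  have inF₁ : ∀ (y : {c // Maximal (· ∈ H) c}) {B}, B ∈ y.1.1 → B.closure ⊆ F :=
    fun y B h => hF B ((hs.bounded _ y.2.prop).1 h)
  have inF₂ : ∀ (y : {c // Maximal (· ∈ H) c}) {B}, B ∈ y.1.2 → B.closure ⊆ F :=
    fun y B h => hF B ((hs.bounded _ y.2.prop).2 h)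
  have modal : ∀ (y : {c // Maximal (· ∈ H) c}), ∀ B ∈ boxPart y.1.1.val + oblPart y.1.1.val,
      B ∈ F := by
    intro y B hB
    simp only [boxPart, oblPart, Multiset.mem_add, Multiset.mem_filter, Finset.mem_val] at hB
    exact (hs.bounded _ y.2.prop).1 (by tauto)
  have neg_right : ∀ (y : {c // Maximal (· ∈ H) c}) {B : BFormula P}, .neg B ∈ y.1.2 →
      B ∈ y.1.1 := by
    intro y B h
    refine hs.mem_left y.2 (inF₂ y h (by simp [BFormula.closure, BFormula.mem_closure_self]))
      fun hp => ?_
    exact hs.not_provable y.2.prop (fun _ => id) (by simpa using h) (ProvableHE.negR _ _ _ _ hp)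
  have bet_right : ∀ (y : {c // Maximal (· ∈ H) c}) {B : BFormula P}, .bet B ∈ y.1.2 →
      ∃ z : {c // Maximal (· ∈ H) c}, (∀ C, BFormula.bet C ∈ y.1.1 → C ∈ z.1.1) ∧
        B ∈ z.1.2 := by
    intro y B h
    have hF' : ∀ C ∈ boxPart y.1.1.val + oblPart y.1.1.val + betPart y.1.1.val, C ∈ F := by
      intro C hC
      rcases Multiset.mem_add.1 hC with hC | hC
      · exact modal y C hC
      · obtain ⟨D, hD, hDC⟩ := (Multiset.mem_filterMap _ _).1 hC
        cases D <;> simp only [BFormula.unBet?, reduceCtorEq, Option.some.injEq] at hDC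
        subst hDC
        exact inF₁ y hD (by simp [BFormula.closure, BFormula.mem_closure_self])
    obtain ⟨z, hz, h₁, h₂⟩ := hs.exists_ge (Δ := {B}) hF'
      (by simpa using inF₂ y h (by simp [BFormula.closure, BFormula.mem_closure_self]))
      fun hp => hs.not_provable y.2.prop (fun _ => id) (by simpa using h)
        (ProvableHE.betR _ _ y.1.2.val _ hp)
    refine ⟨⟨z, hz⟩, fun C hC => h₁ C (Multiset.mem_add.2 (.inr ?_)), h₂ B (by simp)⟩
    exact (Multiset.mem_filterMap _ _).2 ⟨_, hC, rfl⟩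
  induction A generalizing x with
  | var p =>
    refine ⟨id, fun h₂ h₁ => hs.not_provable x.2.prop ?_ ?_
      (ProvableHE.init (toHyp H) x.1.1.val x.1.2.val p)⟩
    · exact Multiset.forall_mem_cons.2 ⟨h₁, fun _ => id⟩
    · simpa using h₂
  | neg A ih =>
    refine ⟨fun h => (ih x).2 ?_, fun h k => k ((ih x).1 (neg_right x h))⟩
    refine hs.mem_right x.2 (inF₁ x h (by simp [BFormula.closure, BFormula.mem_closure_self]))
      fun hp => ?_
    exact hs.not_provable x.2.prop (by simpa using h) (fun _ => id) (ProvableHE.negL _ _ _ _ hp)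
  | imp A B ihA ihB =>
    constructor
    · intro h hA
      have cl := inF₁ x h
      by_contra hB
      refine hs.not_provable x.2.prop (by simpa using h) (fun _ => id)
        (ProvableHE.impL _ x.1.1.val x.1.2.val A B ?_ ?_)
      · by_contra hp
        exact (ihA x).2 (hs.mem_right x.2
          (cl (by simp [BFormula.closure, BFormula.mem_closure_self])) hp) hA
      · by_contra hp
        exact hB ((ihB x).1 (hs.mem_left x.2
          (cl (by simp [BFormula.closure, BFormula.mem_closure_self])) hp))
    · intro h hAB
      have cl := inF₂ x h
      have hm := hs.mem_of_not_provable x.2 (Γ := {A}) (Δ := {B})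
        (by simpa using cl (by simp [BFormula.closure, BFormula.mem_closure_self]))
        (by simpa using cl (by simp [BFormula.closure, BFormula.mem_closure_self]))
        fun hp => hs.not_provable x.2.prop (fun _ => id) (by simpa using h)
          (ProvableHE.impR _ _ x.1.2.val A B (by simpa using hp))
      exact (ihB x).2 (hm.2 B (by simp)) (hAB ((ihA x).1 (hm.1 A (by simp))))
  | box A ih =>
    constructor
    · intro h y
      have hy := hs.spread x.2.prop y.2 h (.inl rfl)
      refine (ih y).1 (hs.mem_left y.2
        (inF₁ x h (by simp [BFormula.closure, BFormula.mem_closure_self])) fun hp => ?_)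
      exact hs.not_provable y.2.prop (by simpa using hy) (fun _ => id)
        (ProvableHE.boxL _ y.1.1.val _ A
          (hp.left_mono (Multiset.cons_subset_cons (Multiset.subset_cons _ _))))
    · intro h k
      obtain ⟨z, hz, -, h₂⟩ := hs.exists_ge (Γ := boxPart x.1.1.val + oblPart x.1.1.val)
        (Δ := {A}) (modal x)
        (by simpa using inF₂ x h (by simp [BFormula.closure, BFormula.mem_closure_self]))
        fun hp => hs.not_provable x.2.prop (fun _ => id) (by simpa using h)
          (ProvableHE.boxR _ _ x.1.2.val _ hp)
      exact (ih ⟨z, hz⟩).2 (h₂ A (by simp)) (k _)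
  | obl B A ihB ihA =>
    constructor
    · intro h y hA hbest
      have cl := inF₁ x h
      have hy := hs.spread x.2.prop y.2 h (.inr rfl)
      -- One premise of the left rule for `○` must be unprovable at `y`. The first would make `A`
      -- false at `y`, the third would make `B` true there; the second puts `Bet ¬A` on the right,
      -- yielding a better `A`-world and contradicting that `y` is best.
      by_contra hB
      refine hs.not_provable y.2.prop (by simpa using hy) (fun _ => id)
        (ProvableHE.oblL _ y.1.1.val y.1.2.val A B ?_ ?_ ?_)
      · by_contra hp
        exact (ihA y).2 (hs.mem_right y.2
          (cl (by simp [BFormula.closure, BFormula.mem_closure_self]))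
          fun hq => hp (hq.left_mono (Multiset.subset_cons _ _))) hA
      · by_contra hp
        obtain ⟨z, hyz, hz⟩ := bet_right y (hs.mem_right y.2
          (cl (by simp [BFormula.closure]))
          fun hq => hp (hq.left_mono (Multiset.subset_cons _ _)))
        exact hbest z hyz ((ihA z).1 (neg_right z hz))
      · by_contra hp
        exact hB ((ihB y).1 (hs.mem_left y.2
          (cl (by simp [BFormula.closure, BFormula.mem_closure_self]))
          fun hq => hp (hq.left_mono (Multiset.cons_subset_cons (Multiset.subset_cons _ _)))))
    · intro h k
      have cl := inF₂ x h
      -- The world `z` is a best `A`-world refuting `B`: having `Bet ¬A` on its left puts `¬A` on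
      -- the left of every better world, hence `A` on the right.
      obtain ⟨z, hz, h₁, h₂⟩ := hs.exists_ge
        (Γ := A ::ₘ .bet (.neg A) ::ₘ (boxPart x.1.1.val + oblPart x.1.1.val)) (Δ := {B})
        (Multiset.forall_mem_cons.2
          ⟨cl (by simp [BFormula.closure, BFormula.mem_closure_self]),
            Multiset.forall_mem_cons.2 ⟨cl (by simp [BFormula.closure]), modal x⟩⟩)
        (by simpa using cl (by simp [BFormula.closure, BFormula.mem_closure_self]))
        fun hp => hs.not_provable x.2.prop (fun _ => id) (by simpa using h)
          (ProvableHE.oblR _ _ x.1.2.val A B hp)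
      refine (ihB ⟨z, hz⟩).2 (h₂ B (by simp))
        (k ⟨z, hz⟩ ((ihA ⟨z, hz⟩).1 (h₁ A (by simp))) fun y hy => (ihA y).2 ?_)
      have hn : BFormula.neg A ∈ y.1.1 := hy _ (h₁ _ (by simp))
      refine hs.mem_right y.2
        (cl (by simp [BFormula.closure, BFormula.mem_closure_self])) fun hp => ?_
      exact hs.not_provable y.2.prop (by simpa using hn) (fun _ => id)
        (ProvableHE.negL _ _ _ _ hp)
  | bet A ih =>
    refine ⟨fun h y hy => (ih y).1 (hy A h), fun h k => ?_⟩
    obtain ⟨z, hxz, hz⟩ := bet_right x h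
    exact (ih z).2 hz (k z hxz)

end Saturated

end Completeness

end AqvistE

/-- Every theorem of **E** has a (cut-free) proof in **HE**. -/
theorem mainTheorem8 {P : Type*} (A : AqvistE.Formula P) (hA : AqvistE.ProvableE A) :
    AqvistE.ProvableHE {AqvistE.Sequent.mk 0 {A.toB}} := by
  by_contra hn
  obtain ⟨H, hH, hs⟩ := AqvistE.exists_saturated A.toB.closure {(∅, {A.toB})}
    (by simpa [AqvistE.toHyp] using hn)
    (by simpa using AqvistE.BFormula.mem_closure_self A.toB)
  -- The component `⇒ A` need not itself be a world, but any maximal component above it still has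
  -- `A` on the right.
  obtain ⟨c, hc, hmax⟩ := H.finite_toSet.exists_le_maximal
    (Finset.mem_coe.2 (hH (Finset.mem_singleton_self _)))
  exact (hs.truth (fun _ => AqvistE.BFormula.closure_subset) A.toB ⟨c, hmax⟩).2
    (hc.2 (Finset.mem_singleton_self _)) (hA.sat _ _ _)
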